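/- A $0$-$1$ matrix $M$ contains a $0$-$1$ matrix $P$ if some submatrix of $M$ (obtained by deleting rows and columns) either equals $P$ or can be turned into $P$ by changing some ones to zeroes; otherwise $M$ avoids $P$. Let $\mathrm{ex}(n,P)$ be the maximum number of ones in an $n\times n$ $0$-$1$ matrix that avoids $P$ (with value $0$ if no such matrix exists). A $0$-$1$ matrix $P$ is called minimally non-linear if $\mathrm{ex}(n,P)=\omega(n)$ but $\mathrm{ex}(n,P')=O(n)$ for every $0$-$1$ matrix $P'$ that is contained in $P$ but not equal to $P$. Lemma. If $M$ is a minimally non-linear $0$-$1$ matrix, then the top row of $M$ contains at most four ones and the bottom row of $M$ contains at most four ones. -/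

import Mathlib

open Filter Asymptotics

namespace ZeroOneMatrix

/-- A `0-1` matrix with `k` rows (numbered from top to bottom) and `l` columns
(numbered from left to right); the entry `true` is a one, the entry `false` a zero. -/
abbrev Mat (k l : ℕ) : Type := Matrix (Fin k) (Fin l) Bool

/-- `Contains M P`: some submatrix of `M` (an increasing choice of rows and an increasing choice of
columns) either equals `P` or can be turned into `P` by changing some ones to zeroes. -/
def Contains {m n k l : ℕ} (M : Mat m n) (P : Mat k l) : Prop :=
  ∃ (f : Fin k ↪o Fin m) (g : Fin l ↪o Fin n),
    ∀ i j, P i j = true → M (f i) (g j) = true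

/-- `M` avoids `P`. -/
def Avoids {m n k l : ℕ} (M : Mat m n) (P : Mat k l) : Prop := ¬ Contains M P

/-- The number of ones of `M`. -/
def numOnes {m n : ℕ} (M : Mat m n) : ℕ :=
  (Finset.univ.filter fun p : Fin m × Fin n => M p.1 p.2 = true).card

/-- The number of ones in row `r` of `M`. -/
def rowOnes {m n : ℕ} (M : Mat m n) (r : Fin m) : ℕ :=
  (Finset.univ.filter fun c : Fin n => M r c = true).card

open Classical in
/-- The extremal function: the maximum number of ones in an `n × n` matrix avoiding `P`
(and `0` if there is no such matrix, which can happen only if `P` has no ones). -/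
noncomputable def ex {k l : ℕ} (n : ℕ) (P : Mat k l) : ℕ :=
  (Finset.univ.filter fun M : Mat n n => Avoids M P).sup numOnes

/-- `ex(n, P) = O(n)`. -/
def IsLinear {k l : ℕ} (P : Mat k l) : Prop :=
  (fun n : ℕ => (ex n P : ℝ)) =O[atTop] (fun n : ℕ => (n : ℝ))

/-- `ex(n, P) = ω(n)`, that is, `n = o(ex(n, P))`. -/
def IsSuperlinear {k l : ℕ} (P : Mat k l) : Prop :=
  (fun n : ℕ => (n : ℝ)) =o[atTop] (fun n : ℕ => (ex n P : ℝ))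

/-- `P` and `P'` are the same matrix (same dimensions, same entries). -/
def Same {k l k' l' : ℕ} (P : Mat k l) (P' : Mat k' l') : Prop :=
  ∃ (hk : k = k') (hl : l = l'), ∀ i j, P i j = P' (Fin.cast hk i) (Fin.cast hl j)

/-- `P` is minimally non-linear: `ex(n, P) = ω(n)`, but `ex(n, P') = O(n)` for every `P'` that is
contained in `P` and is not equal to `P`. -/
def MinimallyNonlinear {k l : ℕ} (P : Mat k l) : Prop :=
  IsSuperlinear P ∧
    ∀ (k' l' : ℕ) (P' : Mat k' l'), Contains P P' → ¬ Same P P' → IsLinear P'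

end ZeroOneMatrix

/-! Suppose the top row has ones in columns `c 0 < ... < c 4`. Two facts give a contradiction.
First, if no other row has a one strictly between two ones of a row, then the ones of that row in
between affect `ex` by at most a constant factor (`numOnes_le_mul_ex`). So in a minimally non-linear
matrix some other row has a one between `c 0` and `c 2`, and some other row has one between `c 2`
and `c 4` (`MinimallyNonlinear.exists_between`). Second, three of the five ones are enough to
complete these two, perhaps after a left-right reflection, to ones at `(x, p), (y, q), (x, r), (z,
s)` with `p < q < r < s` and `x < y ≤ z`. This four-column pattern is already non-linear
(`not_isLinear`), so minimality forbids a fifth column (`MinimallyNonlinear.width_le_four`). The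
bottom row follows by turning the matrix upside down. Non-linearity comes from an Ackermann-type
recursion building staircases with arbitrarily many ones per row and comparably many rows and
columns (`exists_isStaircase`). Sorting the rows by their last ones lets the case `y = z` imply the
case `y < z`. -/

namespace ZeroOneMatrix

/-! ### Staircases: sorted matrices avoiding the alternating pattern -/

section Staircase

variable {R C : Type} [LinearOrder R] [LinearOrder C]

/-- A `0-1` matrix with rows `R` (the smallest on top), with its nonzero columns in `cols`, whose
rows are sorted by their last ones, and which has no ones at `(x, p), (y, q), (x, r), (y, s)` where
`p < q < r < s` and `x < y`.
Every row has at least `k` ones, the first of them in a special column, and every special column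
has exactly `m` ones, all of which are the first ones of their rows. -/
structure IsStaircase [Fintype R] (one : R → C → Prop) (cols special : Finset C) (k m : ℕ) :
    Prop where
  special_subset : special ⊆ cols
  mem_cols : ∀ {r c}, one r c → c ∈ cols
  exists_ones : ∀ r, ∃ s : Finset C, s.card = k ∧ ∀ c ∈ s, one r c
  card_rows : Fintype.card R = m * special.card
  exists_rows : ∀ D ∈ special, ∃ s : Finset R, s.card = m ∧ ∀ r, r ∈ s ↔ one r D
  exists_special : ∀ r, ∃ D ∈ special, one r D
  first : ∀ {D r c}, D ∈ special → one r D → one r c → D ≤ c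
  last : ∀ {x y c}, x < y → one y c → ∃ d, c ≤ d ∧ one x d
  avoids : ∀ {x y p q r s}, p < q → q < r → r < s → x < y →
    one x p → one y q → one x r → one y s → False
  avoids_special : ∀ {x y D r s}, D ∈ special → D < r → r < s → x < y →
    one x D → one y D → one x r → one y s → False

/-- As row `z` is not above row `y`, row `y` reaches at least as far right, so its own one at or
beyond `s` can replace the one in row `z`. -/
theorem IsStaircase.avoids_of_le [Fintype R] {one : R → C → Prop} {cols special : Finset C}
    {k m : ℕ} (h : IsStaircase one cols special k m) {x y z p q r s} (hpq : p < q) (hqr : q < r)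
    (hrs : r < s) (hxy : x < y) (hyz : y ≤ z) (hp : one x p) (hq : one y q) (hr : one x r)
    (hs : one z s) : False := by
  obtain rfl | hyz := hyz.eq_or_lt
  · exact h.avoids hpq hqr hrs hxy hp hq hr hs
  · obtain ⟨d, hd, hyd⟩ := h.last hyz hs
    exact h.avoids hpq hqr (hrs.trans_le hd) hxy hp hq hr hyd

theorem exists_strictAntiOn_bijOn {α β : Type*} [LinearOrder α] [LinearOrder β] (s : Finset α)
    (t : Finset β) (h : s.card = t.card) (b : β) :
    ∃ φ : α → β, StrictAntiOn φ s ∧ Set.BijOn φ s t := by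
  let e : s ≃o Fin t.card := (s.orderIsoOfFin h).symm
  let e' : t ≃o Fin t.card := (t.orderIsoOfFin rfl).symm
  let φ : α → β := fun a => if ha : a ∈ s then (e'.symm (e ⟨a, ha⟩).rev : t) else b
  have hφ : ∀ a (ha : a ∈ s), φ a = (e'.symm (e ⟨a, ha⟩).rev : t) := fun a ha => dif_pos ha
  have hanti : StrictAntiOn φ s := by
    intro a ha a' ha' haa'
    rw [hφ a ha, hφ a' ha']
    simpa using haa'
  refine ⟨φ, hanti, fun a ha => ?_, hanti.injOn, fun c hc => ?_⟩
  · rw [hφ a ha]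
    exact Subtype.coe_prop _
  · refine ⟨e.symm (e' ⟨c, hc⟩).rev, Subtype.coe_prop _, ?_⟩
    rw [hφ _ (Subtype.coe_prop _)]
    simp

end Staircase

/-! ### Composition of two staircases -/

/-- The rows of a composition: the old rows `R`, and a copy of `R'` for each `D : S`. -/
inductive ComposeRow (R S R' : Type)
  | old (b : R) : ComposeRow R S R'
  | new (D : S) (l : R') : ComposeRow R S R'

namespace ComposeRow

variable {R S R' : Type}

/-- The rows of a composition form a disjoint union. -/
def equivSum : ComposeRow R S R' ≃ R ⊕ S × R' where
  toFun
    | old b => Sum.inl b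
    | new D l => Sum.inr (D, l)
  invFun
    | Sum.inl b => old b
    | Sum.inr (D, l) => new D l
  left_inv x := by cases x <;> rfl
  right_inv x := by rcases x with _ | ⟨_, _⟩ <;> rfl

noncomputable instance [Fintype R] [Fintype S] [Fintype R'] : Fintype (ComposeRow R S R') :=
  Fintype.ofEquiv _ equivSum.symm

/-- The rows of a composition can be sorted by their last ones. -/
theorem exists_linearOrder {C : Type} [LinearOrder R] [LinearOrder C] [LinearOrder R']
    {special : Finset C} (last : R → C) (hlast : ∀ x y, x < y → last y ≤ last x) :
    ∃ _ : LinearOrder (ComposeRow R {D // D ∈ special} R'),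
      (∀ x y : R, (old x : ComposeRow R {D // D ∈ special} R') < old y ↔ x < y) ∧
      (∀ (x : R) (D : {D // D ∈ special}) (l : R'), old x < new D l ↔ D.1 ≤ last x) ∧
      ∀ (D E : {D // D ∈ special}) (l l' : R'), (new D l : ComposeRow R _ R') < new E l' ↔
        E.1 < D.1 ∨ D = E ∧ l < l' := by
  -- Rows are sorted by decreasing last column of `T`, a new row counting as ending in its `D`. On a
  -- tie the old row comes first, because it ends in `D` itself, to the right of the whole copy of
  -- `L`.
  let key : ComposeRow R {D // D ∈ special} R' → Cᵒᵈ ×ₗ (R ⊕ₗ R') := fun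
    | old b => toLex (OrderDual.toDual (last b), toLex (Sum.inl b))
    | new D l => toLex (OrderDual.toDual D.1, toLex (Sum.inr l))
  have hkey : Function.Injective key := by
    rintro (b | ⟨D, l⟩) (b' | ⟨D', l'⟩) h
    · exact congrArg old (Sum.inl_injective (congrArg (·.2) h))
    · exact absurd (congrArg (·.2) h) Sum.inl_ne_inr
    · exact absurd (congrArg (·.2) h) Sum.inr_ne_inl
    · rw [Subtype.ext (congrArg (·.1) h : D.1 = D'.1),
        (Sum.inr_injective (congrArg (·.2) h) : l = l')]
  refine ⟨LinearOrder.lift' key hkey, fun x y => ?_, fun x D l => ?_, fun D E l l' => ?_⟩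
  · change key (old x) < key (old y) ↔ _
    rw [Prod.Lex.lt_iff']
    change last y ≤ last x ∧ (last x = last y →
      (toLex (Sum.inl x) : R ⊕ₗ R') < toLex (Sum.inl y)) ↔ _
    rw [Sum.Lex.inl_lt_inl_iff]
    refine ⟨fun h => ?_, fun h => ⟨hlast x y h, fun _ => h⟩⟩
    by_contra hxy
    obtain rfl | hxy := (not_lt.1 hxy).eq_or_lt
    · exact lt_irrefl _ (h.2 rfl)
    · exact hxy.not_gt (h.2 ((hlast y x hxy).antisymm h.1))
  · change key (old x) < key (new D l) ↔ _
    rw [Prod.Lex.lt_iff']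
    exact and_iff_left fun _ => Sum.Lex.inl_lt_inr _ _
  · change key (new D l) < key (new E l') ↔ _
    rw [Prod.Lex.lt_iff]
    change E.1 < D.1 ∨ D.1 = E.1 ∧ (toLex (Sum.inr l) : R ⊕ₗ R') < toLex (Sum.inr l') ↔ _
    rw [Sum.Lex.inr_lt_inr_iff, Subtype.ext_iff]

end ComposeRow

section Compose

open ComposeRow

variable {R C R' C' : Type}

/-- The composition of two matrices `T` and `L`: every special column `D` of `T` is replaced by
a copy of `L` on new rows, followed by `D` itself; the one in row `b` of `D` is repeated in
the column `φ D b` of that copy. -/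
def compose (T : R → C → Prop) (special : Finset C) (L : R' → C' → Prop) (φ : C → R → C') :
    ComposeRow R {D // D ∈ special} R' → C ×ₗ WithTop C' → Prop
  | old b, c => T b (ofLex c).1 ∧ ((ofLex c).2 = ⊤ ∨
      (ofLex c).1 ∈ special ∧ (ofLex c).2 = (φ (ofLex c).1 b : WithTop C'))
  | new D l, c => (ofLex c).1 = D.1 ∧ ∃ j : C', (ofLex c).2 = j ∧ L l j

variable [LinearOrder R] [LinearOrder C] [LinearOrder R'] [LinearOrder C']
  {T : R → C → Prop} {special : Finset C} {L : R' → C' → Prop} {φ : C → R → C'}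

/-- Each old row gains one entry, in the copy at its special column, and each special column of a
copy gains one old row. No alternation arises inside a copy because `φ D` reverses the order of the
old rows. Collapsing a copy to its column `D` may identify `p` with `q`; the field `avoids_special`
excludes this degenerate alternation. -/
theorem isStaircase_compose [Fintype R] [Fintype R'] {cols : Finset C} {cols' special' : Finset C'}
    {k m : ℕ} (hT : IsStaircase T cols special k special'.card)
    (hL : IsStaircase L cols' special' (k + 1) m)
    (hanti : ∀ D ∈ special, StrictAntiOn (φ D) {b | T b D})
    (hbij : ∀ D ∈ special, Set.BijOn (φ D) {b | T b D} special') (last : R → C)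
    (hlast : ∀ x, T x (last x)) (hlast_le : ∀ x c, T x c → c ≤ last x)
    [LinearOrder (ComposeRow R {D // D ∈ special} R')]
    (hoo : ∀ x y : R, (old x : ComposeRow R {D // D ∈ special} R') < old y ↔ x < y)
    (hon : ∀ (x : R) (D : {D // D ∈ special}) (l : R'), old x < new D l ↔ D.1 ≤ last x)
    (hnn : ∀ (D E : {D // D ∈ special}) (l l' : R'), (new D l : ComposeRow R _ R') < new E l' ↔
        E.1 < D.1 ∨ D = E ∧ l < l') :
    IsStaircase (compose T special L φ)
      (cols.map ⟨fun c => toLex (c, (⊤ : WithTop C')), fun _ _ h => congrArg (·.1) h⟩ ∪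
        (special ×ˢ cols').map ⟨fun d => toLex (d.1, (d.2 : WithTop C')), fun _ _ h =>
          Prod.ext (congrArg (·.1) h) (WithTop.coe_injective (congrArg (·.2) h))⟩)
      ((special ×ˢ special').map ⟨fun d => toLex (d.1, (d.2 : WithTop C')), fun _ _ h =>
          Prod.ext (congrArg (·.1) h) (WithTop.coe_injective (congrArg (·.2) h))⟩)
      (k + 1) (m + 1) where
  special_subset := by
    refine Finset.Subset.trans ?_ Finset.subset_union_right
    exact Finset.map_subset_map.2 (Finset.product_subset_product_right hL.special_subset)
  mem_cols := by
    intro r c h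
    obtain ⟨⟨c, j⟩, rfl⟩ := toLex.surjective c
    obtain b | ⟨D, l⟩ := r
    · obtain ⟨h1, h3 | ⟨h2, h3⟩⟩ := h <;> simp only [ofLex_toLex] at h1 h3
      · subst h3
        exact Finset.mem_union_left _ (Finset.mem_map.2 ⟨c, hT.mem_cols h1, rfl⟩)
      · subst h3
        exact Finset.mem_union_right _ (Finset.mem_map.2 ⟨(c, φ c b), Finset.mem_product.2
          ⟨h2, hL.special_subset ((hbij c h2).mapsTo h1)⟩, rfl⟩)
    · obtain ⟨rfl, j, rfl, h⟩ := h
      exact Finset.mem_union_right _ (Finset.mem_map.2 ⟨(_, j), Finset.mem_product.2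
        ⟨D.2, hL.mem_cols h⟩, rfl⟩)
  exists_ones := by
    intro r
    obtain b | ⟨D, l⟩ := r
    · obtain ⟨s, hs, hsT⟩ := hT.exists_ones b
      obtain ⟨D, hD, hDb⟩ := hT.exists_special b
      refine ⟨Finset.cons (toLex (D, (φ D b : WithTop C')))
        (s.map ⟨fun c => toLex (c, (⊤ : WithTop C')), fun _ _ h => congrArg (·.1) h⟩) ?_, ?_, ?_⟩
      · intro h
        obtain ⟨c, _, hc⟩ := Finset.mem_map.1 h
        exact WithTop.top_ne_coe (congrArg (·.2) hc)
      · rw [Finset.card_cons, Finset.card_map, hs]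
      · intro c hc
        obtain rfl | hc := Finset.mem_cons.1 hc
        · exact ⟨hDb, Or.inr ⟨hD, rfl⟩⟩
        · obtain ⟨c', hc', rfl⟩ := Finset.mem_map.1 hc
          exact ⟨hsT c' hc', Or.inl rfl⟩
    · obtain ⟨s, hs, hsL⟩ := hL.exists_ones l
      refine ⟨s.map ⟨fun c : C' => toLex (D.1, (c : WithTop C')),
        fun _ _ h => WithTop.coe_injective (congrArg (·.2) h)⟩, ?_, ?_⟩
      · rw [Finset.card_map, hs]
      · intro c hc
        obtain ⟨j, hj, rfl⟩ := Finset.mem_map.1 hc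
        exact ⟨rfl, j, rfl, hsL j hj⟩
  card_rows := by
    rw [Fintype.card_congr equivSum, Fintype.card_sum, Fintype.card_prod, Fintype.card_coe,
      hT.card_rows, hL.card_rows, Finset.card_map, Finset.card_product]
    ring
  exists_rows := by
    intro D' hD'
    obtain ⟨⟨D, j⟩, hDj, rfl⟩ := Finset.mem_map.1 hD'
    obtain ⟨hD, hj⟩ := Finset.mem_product.1 hDj
    obtain ⟨s, hs, hsL⟩ := hL.exists_rows j hj
    obtain ⟨b, hb, rfl⟩ := (hbij D hD).surjOn hj
    refine ⟨Finset.cons (old b)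
      (s.map ⟨new ⟨D, hD⟩, fun _ _ h => (ComposeRow.new.inj h).2⟩) ?_, ?_, ?_⟩
    · intro h
      obtain ⟨c, _, hc⟩ := Finset.mem_map.1 h
      cases hc
    · rw [Finset.card_cons, Finset.card_map, hs]
    · intro r
      rw [Finset.mem_cons, Finset.mem_map]
      constructor
      · rintro (rfl | ⟨l, hl, rfl⟩)
        · exact ⟨hb, Or.inr ⟨hD, rfl⟩⟩
        · exact ⟨rfl, _, rfl, (hsL l).1 hl⟩
      · intro h
        obtain b' | ⟨E, l⟩ := r
        · obtain ⟨h1, h2 | ⟨_, h2⟩⟩ := h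
          · exact absurd h2 WithTop.coe_ne_top
          · left
            rw [(hbij D hD).injOn h1 hb (WithTop.coe_injective h2).symm]
        · obtain ⟨h1, i, h2, h3⟩ := h
          right
          obtain rfl := WithTop.coe_injective h2
          refine ⟨l, (hsL l).2 h3, ?_⟩
          rw [(Subtype.ext h1.symm : E = ⟨D, hD⟩)]
          rfl
  exists_special := by
    intro r
    obtain b | ⟨D, l⟩ := r
    · obtain ⟨D, hD, hDb⟩ := hT.exists_special b
      exact ⟨_, Finset.mem_map.2 ⟨(D, φ D b), Finset.mem_product.2 ⟨hD, (hbij D hD).mapsTo hDb⟩,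
        rfl⟩, hDb, Or.inr ⟨hD, rfl⟩⟩
    · obtain ⟨j, hj, hjl⟩ := hL.exists_special l
      exact ⟨_, Finset.mem_map.2 ⟨(D.1, j), Finset.mem_product.2 ⟨D.2, hj⟩, rfl⟩, rfl, j, rfl, hjl⟩
  first := by
    intro D' r c hD' h h'
    obtain ⟨⟨D, j⟩, hDj, rfl⟩ := Finset.mem_map.1 hD'
    obtain ⟨hD, hj⟩ := Finset.mem_product.1 hDj
    obtain ⟨⟨c, i⟩, rfl⟩ := toLex.surjective c
    obtain b | ⟨E, l⟩ := r
    · obtain ⟨h1, h2 | ⟨_, h2⟩⟩ := h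
      · exact absurd h2 WithTop.coe_ne_top
      refine Prod.Lex.toLex_le_toLex'.2 ⟨hT.first hD h1 h'.1, ?_⟩
      rintro rfl
      obtain ⟨-, h3 | ⟨-, h3⟩⟩ := h'
      · exact h3 ▸ le_top
      · exact (h2.trans h3.symm).le
    · obtain ⟨h1, i, h2, h3⟩ := h
      obtain ⟨h1', i', h2', h3'⟩ := h'
      obtain rfl := WithTop.coe_injective h2
      refine Prod.Lex.toLex_le_toLex'.2 ⟨(h1.trans h1'.symm).le, fun _ => ?_⟩
      exact h2'.symm ▸ WithTop.coe_le_coe.2 (hL.first hj h3 h3')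
  last := by
    intro x y c hxy hc
    obtain ⟨⟨c, j⟩, rfl⟩ := toLex.surjective c
    obtain x | ⟨D, x⟩ := x <;> obtain y | ⟨E, y⟩ := y
    · obtain ⟨d, hd, hxd⟩ := hT.last ((hoo x y).1 hxy) hc.1
      exact ⟨toLex (d, ⊤), Prod.Lex.toLex_le_toLex'.2 ⟨hd, fun _ => le_top⟩, hxd, Or.inl rfl⟩
    · obtain ⟨rfl, -⟩ := hc
      exact ⟨toLex (last x, ⊤), Prod.Lex.toLex_le_toLex'.2 ⟨(hon x E y).1 hxy, fun _ => le_top⟩,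
        hlast x, Or.inl rfl⟩
    · obtain ⟨d, -, hd⟩ := hL.exists_special x
      have hc' : c < D.1 := (hlast_le y c hc.1).trans_lt
        (lt_of_not_ge fun h => hxy.not_gt ((hon y D x).2 h))
      exact ⟨toLex (D.1, (d : WithTop C')), Prod.Lex.toLex_le_toLex.2 (Or.inl hc'), rfl, d, rfl, hd⟩
    · obtain ⟨rfl, j, rfl, h⟩ := hc
      obtain hDE | ⟨rfl, hxy'⟩ := (hnn D E x y).1 hxy
      · obtain ⟨d, -, hd⟩ := hL.exists_special x
        exact ⟨toLex (D.1, (d : WithTop C')), Prod.Lex.toLex_le_toLex.2 (Or.inl hDE), rfl, d, rfl,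
          hd⟩
      · obtain ⟨d, hd, hxd⟩ := hL.last hxy' h
        exact ⟨toLex (D.1, (d : WithTop C')),
          Prod.Lex.toLex_le_toLex'.2 ⟨le_rfl, fun _ => WithTop.coe_le_coe.2 hd⟩, rfl, d, rfl, hxd⟩
  avoids := by
    intro x y p q r s hpq hqr hrs hxy hp hq hr hs
    obtain ⟨⟨p, p'⟩, rfl⟩ := toLex.surjective p
    obtain ⟨⟨q, q'⟩, rfl⟩ := toLex.surjective q
    obtain ⟨⟨r, r'⟩, rfl⟩ := toLex.surjective r
    obtain ⟨⟨s, s'⟩, rfl⟩ := toLex.surjective s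
    obtain ⟨hpq1, hpq2⟩ := Prod.Lex.toLex_lt_toLex'.1 hpq
    obtain ⟨hqr1, hqr2⟩ := Prod.Lex.toLex_lt_toLex'.1 hqr
    obtain ⟨hrs1, hrs2⟩ := Prod.Lex.toLex_lt_toLex'.1 hrs
    simp only at hpq1 hpq2 hqr1 hqr2 hrs1 hrs2
    obtain x | ⟨D, x⟩ := x <;> obtain y | ⟨E, y⟩ := y
    · rw [hoo] at hxy
      obtain ⟨hp1, hp2⟩ := hp
      obtain ⟨hq1, hq2⟩ := hq
      obtain ⟨hr1, hr2⟩ := hr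
      obtain ⟨hs1, -⟩ := hs
      simp only [ofLex_toLex] at hp1 hp2 hq1 hq2 hr1 hr2 hs1
      -- If `p`, `q`, `r` lay in one block, the entries at `p` and `q` would be values of `φ`
      -- increasing from row `x` to row `y`.
      have hpr : p < r := by
        refine (hpq1.trans hqr1).lt_of_ne ?_
        rintro rfl
        obtain rfl := hpq1.antisymm hqr1
        obtain ⟨hp, rfl⟩ := hp2.resolve_left ((hpq2 rfl).trans (hqr2 rfl)).ne_top
        obtain ⟨-, rfl⟩ := hq2.resolve_left (hqr2 rfl).ne_top
        exact (hanti _ hp hp1 hq1 hxy).not_gt (WithTop.coe_lt_coe.1 (hpq2 rfl))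
      have hr : r ∉ special := fun h => hpr.not_ge (hT.first h hr1 hp1)
      obtain rfl : r' = ⊤ := hr2.resolve_right fun h => hr h.1
      have hqr' : q < r := by
        refine hqr1.lt_of_ne ?_
        rintro rfl
        exact hr (hq2.resolve_left (hqr2 rfl).ne).1
      have hrs' : r < s := hrs1.lt_of_ne fun h => not_top_lt (hrs2 h)
      obtain rfl | hpq' := hpq1.eq_or_lt
      · exact hT.avoids_special (hp2.resolve_left (hpq2 rfl).ne_top).1 hqr' hrs' hxy hp1 hq1 hr1 hs1
      · exact hT.avoids hpq' hqr' hrs' hxy hp1 hq1 hr1 hs1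
    · obtain ⟨hq1, q', rfl, hq⟩ := hq
      obtain ⟨hs1, s', rfl, hs⟩ := hs
      simp only [ofLex_toLex] at hq1 hs1
      -- Block `E` contains `q` and `s`, hence `r`. Row `x` starts in that block and has a single
      -- one in the copy there, so it cannot supply both `p` and `r`.
      obtain rfl : r = E.1 := (hrs1.trans hs1.le).antisymm (hq1.ge.trans hqr1)
      have h := hr.2.resolve_left (hrs2 hs1.symm).ne_top
      have hpr : p = E.1 := (hpq1.trans hqr1).antisymm (hT.first E.2 hr.1 hp.1)
      have hp2 := hp.2.resolve_left ((hpq2 (hpr.trans hq1.symm)).trans (hqr2 hq1)).ne_top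
      have := (hpq2 (hpr.trans hq1.symm)).trans (hqr2 hq1)
      simp only [ofLex_toLex] at hp2 h
      rw [hp2.2, h.2, hpr] at this
      exact lt_irrefl _ this
    · obtain ⟨hp1, p', rfl, hp⟩ := hp
      obtain ⟨hr1, r', rfl, hr⟩ := hr
      simp only [ofLex_toLex] at hp1 hr1
      have hqD : q = D.1 := (hqr1.trans hr1.le).antisymm (hp1.ge.trans hpq1)
      -- An old row with a one in block `D` reaches `D`, so it lies above the new rows of `D`.
      exact hxy.not_gt ((hon y D x).2 (hlast_le y _ (hqD ▸ hq.1)))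
    · obtain ⟨hp1, p', rfl, hp⟩ := hp
      obtain ⟨hr1, r', rfl, hr⟩ := hr
      obtain ⟨hq1, q', rfl, hq⟩ := hq
      obtain ⟨hs1, s', rfl, hs⟩ := hs
      simp only [ofLex_toLex] at hp1 hr1 hq1 hs1
      have hDE : D.1 = E.1 := (hp1.ge.trans (hpq1.trans hq1.le)).antisymm
        (hq1.ge.trans (hqr1.trans hr1.le))
      obtain h | ⟨rfl, h⟩ := (hnn D E x y).1 hxy
      · exact h.ne' hDE
      · exact hL.avoids (WithTop.coe_lt_coe.1 (hpq2 (hp1.trans hq1.symm)))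
          (WithTop.coe_lt_coe.1 (hqr2 (hq1.trans hr1.symm)))
          (WithTop.coe_lt_coe.1 (hrs2 (hr1.trans hs1.symm))) h hp hq hr hs
  avoids_special := by
    intro x y D' r s hD' hDr hrs hxy hxD hyD hr hs
    obtain ⟨⟨D, j⟩, hDj, rfl⟩ := Finset.mem_map.1 hD'
    obtain ⟨hD, hj⟩ := Finset.mem_product.1 hDj
    obtain ⟨⟨r, r'⟩, rfl⟩ := toLex.surjective r
    obtain ⟨⟨s, s'⟩, rfl⟩ := toLex.surjective s
    obtain ⟨hDr1, hDr2⟩ := Prod.Lex.toLex_lt_toLex'.1 hDr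
    obtain ⟨hrs1, hrs2⟩ := Prod.Lex.toLex_lt_toLex'.1 hrs
    simp only at hDr1 hDr2 hrs1 hrs2
    obtain x | ⟨E, x⟩ := x <;> obtain y | ⟨F, y⟩ := y
    · rw [hoo] at hxy
      obtain ⟨hx1, hx2⟩ := hxD
      obtain ⟨hy1, hy2⟩ := hyD
      have hx3 := (hx2.resolve_left WithTop.coe_ne_top).2
      have hy3 := (hy2.resolve_left WithTop.coe_ne_top).2
      exact (hanti D hD hx1 hy1 hxy).ne (WithTop.coe_injective (hy3.symm.trans hx3))
    · obtain ⟨hx1, hx2⟩ := hxD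
      have hx3 := (hx2.resolve_left WithTop.coe_ne_top).2
      obtain ⟨rfl, -⟩ := hyD
      obtain ⟨hs1, s', rfl, hs⟩ := hs
      simp only [ofLex_toLex] at hs1
      have hrD : r = F.1 := (hrs1.trans hs1.le).antisymm hDr1
      have hr2 := (hr.2.resolve_left (hrs2 (hrD.trans hs1.symm)).ne_top).2
      have := hDr2 hrD.symm
      simp only [ofLex_toLex] at hr2
      rw [hr2, hrD] at this
      exact this.ne hx3
    · obtain ⟨hE, -⟩ := hxD
      have : E.1 ≤ last y := hlast_le y _ (hE ▸ hyD.1)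
      exact hxy.not_gt ((hon y E x).2 this)
    · obtain ⟨hE, j', hj', hxj⟩ := hxD
      obtain ⟨hF, j'', hj'', hyj⟩ := hyD
      obtain rfl := WithTop.coe_injective hj'
      obtain rfl := WithTop.coe_injective hj''
      obtain ⟨hr1, r', rfl, hr⟩ := hr
      obtain ⟨hs1, s', rfl, hs⟩ := hs
      simp only [ofLex_toLex] at hr1 hs1
      have hE' : D = E.1 := hE
      have hF' : D = F.1 := hF
      obtain h | ⟨rfl, h⟩ := (hnn E F x y).1 hxy
      · exact h.ne (hF'.symm.trans hE')
      · exact hL.avoids_special hj (WithTop.coe_lt_coe.1 (hDr2 (hE'.trans hr1.symm)))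
          (WithTop.coe_lt_coe.1 (hrs2 (hr1.trans hs1.symm))) h hxj hyj hr hs

/-- Double induction: `L` comes from `(k + 1, m)`, and `T` from `k` with as many ones per special
column as `L` has special columns. For large `K` the number of columns per special column is about
`1 + k * m / K`. The bound `K ≤ special.card` needs `0 < k`, since the base case has one column. -/
theorem exists_isStaircase (K : ℕ) (hK : 0 < K) (k m : ℕ) :
    ∃ (R C : Type) (_ : Fintype R) (_ : LinearOrder R) (_ : LinearOrder C) (one : R → C → Prop)
      (cols special : Finset C), IsStaircase one cols special (k + 1) m ∧
        (0 < k → K ≤ special.card) ∧ 0 < special.card ∧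
        K * cols.card ≤ special.card * (K + k * m) := by
  induction k generalizing m with
  | zero =>
    refine ⟨Fin m, Fin 1, inferInstance, inferInstance, inferInstance, fun _ _ => True,
      Finset.univ, Finset.univ, ?_, by simp, by simp, by simp⟩
    constructor
    · simp
    · simp
    · exact fun r => ⟨Finset.univ, by simp, by simp⟩
    · simp
    · exact fun D _ => ⟨Finset.univ, by simp, by simp⟩
    · simp
    · intro D r c _ _ _
      exact (Subsingleton.elim D c).le
    · exact fun {_ _ c} _ _ => ⟨c, le_rfl, trivial⟩
    · intro x y p q r s h
      exact absurd h (Subsingleton.elim p q).not_lt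
    · intro x y p q r _ h
      exact absurd h (Subsingleton.elim p q).not_lt
  | succ k ihk =>
    induction m with
    | zero =>
      refine ⟨Fin 0, Fin K, inferInstance, inferInstance, inferInstance, fun _ _ => True,
        Finset.univ, Finset.univ, ?_, by simp, by simpa, by simp⟩
      constructor
      · simp
      · simp
      · exact fun r => r.elim0
      · simp
      · exact fun D _ => ⟨Finset.univ, by simp, by simp⟩
      · exact fun r => r.elim0
      · exact fun {_ r} => r.elim0
      · exact fun {r} => r.elim0
      · exact fun {r} => r.elim0
      · exact fun {r} => r.elim0
    | succ m ihm =>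
      obtain ⟨R', C', _, _, _, L, cols', special', hL, hL1, hL2, hL3⟩ := ihm
      obtain ⟨R, C, _, _, _, T, cols, special, hT, hT1, hT2, hT3⟩ := ihk special'.card
      obtain ⟨j₀, _⟩ := Finset.card_pos.1 hL2
      have hφ : ∀ D, ∃ φ : R → C', D ∈ special →
          StrictAntiOn φ {b | T b D} ∧ Set.BijOn φ {b | T b D} special' := by
        intro D
        by_cases hD : D ∈ special
        · obtain ⟨s, hs, hsT⟩ := hT.exists_rows D hD
          obtain ⟨φ, h1, h2⟩ := exists_strictAntiOn_bijOn s special' hs j₀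
          have : (s : Set R) = {b | T b D} := by ext b; simp [hsT]
          exact ⟨φ, fun _ => this ▸ ⟨h1, h2⟩⟩
        · exact ⟨fun _ => j₀, fun h => absurd h hD⟩
      choose φ hφ using hφ
      have hlast : ∀ x, ∃ d, T x d ∧ ∀ c, T x c → c ≤ d := by
        intro x
        obtain ⟨D, -, hD⟩ := hT.exists_special x
        obtain ⟨d, hd, hmax⟩ := ((cols.finite_toSet.subset fun c hc =>
          hT.mem_cols hc).exists_le_maximal (show D ∈ {c | T x c} from hD)).imp fun d h => h.2
        exact ⟨d, hd, fun c hc => le_of_not_gt fun h => h.not_ge (hmax hc h.le)⟩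
      choose last hlast hlast_le using hlast
      obtain ⟨_, hoo, hon, hnn⟩ := ComposeRow.exists_linearOrder (R' := R') (special := special) last
        fun x y hxy => by
          obtain ⟨d, hd, hxd⟩ := hT.last hxy (hlast y)
          exact hd.trans (hlast_le x d hxd)
      refine ⟨_, _, inferInstance, inferInstance, inferInstance, _, _, _,
        isStaircase_compose hT hL (fun D hD => (hφ D hD).1) (fun D hD => (hφ D hD).2) last hlast
          hlast_le hoo hon hnn, ?_, ?_, ?_⟩
      · intro _
        rw [Finset.card_map, Finset.card_product]
        nlinarith [hL1 k.succ_pos]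
      · rw [Finset.card_map, Finset.card_product]
        positivity
      -- The columns of `T` are shared among the many special columns of `L`: `K ≤ special'.card`
      -- absorbs the `K` in the bound for `T`.
      · have hle := hL1 k.succ_pos
        refine (Nat.mul_le_mul_left K (Finset.card_union_le _ _)).trans ?_
        simp only [Finset.card_map, Finset.card_product]
        calc K * (cols.card + special.card * cols'.card)
            = K * cols.card + special.card * (K * cols'.card) := by ring
          _ ≤ special.card * (K + k * special'.card) +
              special.card * (special'.card * (K + (k + 1) * m)) := by gcongr
          _ ≤ special.card * (special'.card + k * special'.card) +
              special.card * (special'.card * (K + (k + 1) * m)) := by gcongr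
          _ = special.card * special'.card * (K + (k + 1) * (m + 1)) := by ring

end Compose

/-! ### Dense matrices and non-linear patterns -/

theorem numOnes_le_ex {k l n : ℕ} {P : Mat k l} {A : Mat n n} (h : Avoids A P) :
    numOnes A ≤ ex n P := by
  classical
  exact Finset.le_sup (f := numOnes) (Finset.mem_filter.2 ⟨Finset.mem_univ A, h⟩)

theorem ex_le {k l n b : ℕ} {P : Mat k l} (h : ∀ A : Mat n n, Avoids A P → numOnes A ≤ b) :
    ex n P ≤ b := by
  classical
  exact Finset.sup_le fun A hA => h A (Finset.mem_filter.1 hA).2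

section Nonlinear

/-- There are square matrices of large density with no ones at `(x, p), (y, q), (x, r), (z, s)`
where `p < q < r < s` and `x < y ≤ z`. -/
theorem exists_dense_mat (c N : ℕ) : ∃ n, N < n ∧ ∃ A : Mat n n, c * n ≤ numOnes A ∧
    ∀ x y z p q r s, p < q → q < r → r < s → x < y → y ≤ z → A x p = true → A y q = true →
      A x r = true → A z s = true → False := by
  classical
  -- With `m = N + 1` and `f` special columns there are `m * f` rows with `2 * c + 1` ones each and
  -- at most `2 * m * f` nonzero columns, so a square of side `2 * m * f` suffices.
  obtain ⟨R, C, _, _, _, one, cols, special, hS, -, hpos, hcols⟩ :=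
    exists_isStaircase (2 * c + 1) (2 * c).succ_pos (2 * c) (N + 1)
  set f := special.card with hf
  have hR : Fintype.card R = (N + 1) * f := hS.card_rows
  have hRn : Fintype.card R ≤ 2 * ((N + 1) * f) := by lia
  have hCn : cols.card ≤ 2 * ((N + 1) * f) := by
    refine Nat.le_of_mul_le_mul_left (hcols.trans ?_) (2 * c).succ_pos
    calc f * (2 * c + 1 + 2 * c * (N + 1))
        ≤ f * ((2 * c + 1) * (N + 1) + (2 * c + 1) * (N + 1)) := by
          gcongr
          · exact Nat.le_mul_of_pos_right _ N.succ_pos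
          · exact (2 * c).le_succ
      _ = (2 * c + 1) * (2 * ((N + 1) * f)) := by ring
  let u : R ↪o Fin (2 * ((N + 1) * f)) :=
    (Fintype.orderIsoFinOfCardEq R rfl).symm.toOrderEmbedding.trans (Fin.castLEOrderEmb hRn)
  let v : cols ↪o Fin (2 * ((N + 1) * f)) :=
    (cols.orderIsoOfFin rfl).symm.toOrderEmbedding.trans (Fin.castLEOrderEmb hCn)
  refine ⟨2 * ((N + 1) * f), by nlinarith, fun i j => decide (∃ r c, u r = i ∧ v c = j ∧ one r c),
    ?_, ?_⟩
  · choose s hs hs' using hS.exists_ones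
    have hcard : (Finset.univ.sigma s).card = c * (2 * ((N + 1) * f)) + (N + 1) * f := by
      rw [Finset.card_sigma, Finset.sum_congr rfl fun r _ => hs r, Finset.sum_const,
        Finset.card_univ, hR, smul_eq_mul]
      ring
    refine (Nat.le_add_right _ ((N + 1) * f)).trans (hcard.ge.trans ?_)
    refine Finset.card_le_card_of_injOn
      -- The second branch is a dummy value: every one lies in `cols`.
      (fun d => (u d.1, if h : d.2 ∈ cols then v ⟨d.2, h⟩ else u d.1)) ?_ ?_
    · rintro ⟨r, d⟩ hd
      have hrd := hs' r d (Finset.mem_sigma.1 hd).2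
      have hd' := hS.mem_cols hrd
      simp only [Finset.coe_filter, Finset.mem_univ, true_and, Set.mem_ofPred_eq, dif_pos hd',
        decide_eq_true_eq]
      exact ⟨r, ⟨d, hd'⟩, rfl, rfl, hrd⟩
    · rintro ⟨r, d⟩ hd ⟨r', d'⟩ hd' h
      have h1 := hS.mem_cols (hs' r d (Finset.mem_sigma.1 hd).2)
      have h2 := hS.mem_cols (hs' r' d' (Finset.mem_sigma.1 hd').2)
      simp only [dif_pos h1, dif_pos h2, Prod.mk.injEq, EmbeddingLike.apply_eq_iff_eq,
        Subtype.mk.injEq] at h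
      obtain ⟨rfl, rfl⟩ := h
      rfl
  · intro x y z p q r s hpq hqr hrs hxy hyz hp hq hr hs
    rw [decide_eq_true_eq] at hp hq hr hs
    obtain ⟨x, p, rfl, rfl, hp⟩ := hp
    obtain ⟨y, q, rfl, rfl, hq⟩ := hq
    obtain ⟨x', r, hx, rfl, hr⟩ := hr
    obtain ⟨z, s, rfl, rfl, hs⟩ := hs
    obtain rfl := u.injective hx
    exact hS.avoids_of_le (v.lt_iff_lt.1 hpq) (v.lt_iff_lt.1 hqr) (v.lt_iff_lt.1 hrs)
      (u.lt_iff_lt.1 hxy) (u.le_iff_le.1 hyz) hp hq hr hs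

theorem not_isLinear {k l : ℕ} {P : Mat k l} (x y z : Fin k) (p q r s : Fin l) (hpq : p < q)
    (hqr : q < r) (hrs : r < s) (hxy : x < y) (hyz : y ≤ z) (hp : P x p = true)
    (hq : P y q = true) (hr : P x r = true) (hs : P z s = true) : ¬ IsLinear P := by
  intro h
  obtain ⟨c, hc⟩ := h.bound
  obtain ⟨N, hN⟩ := eventually_atTop.1 hc
  obtain ⟨n, hn, A, hA, hav⟩ := exists_dense_mat (⌈c⌉₊ + 1) N
  have hA' : Avoids A P := fun ⟨f, g, hfg⟩ => hav (f x) (f y) (f z) (g p) (g q) (g r) (g s)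
    (g.lt_iff_lt.2 hpq) (g.lt_iff_lt.2 hqr) (g.lt_iff_lt.2 hrs) (f.lt_iff_lt.2 hxy)
    (f.le_iff_le.2 hyz) (hfg _ _ hp) (hfg _ _ hq) (hfg _ _ hr) (hfg _ _ hs)
  have h1 := hN n hn.le
  rw [Real.norm_natCast, Real.norm_natCast] at h1
  have h2 : ((⌈c⌉₊ : ℝ) + 1) * n ≤ ex n P := by exact_mod_cast hA.trans (numOnes_le_ex hA')
  have h3 : (0 : ℝ) < n := by exact_mod_cast (Nat.zero_le N).trans_lt hn
  nlinarith [Nat.le_ceil c]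

end Nonlinear

/-! ### Symmetry under reflections -/

section Reflection

variable {k l m n : ℕ}

/-- The matrix `M` turned upside down if `u`, and turned left to right if `v`. -/
def reflect (u v : Bool) (M : Mat m n) : Mat m n :=
  fun i j => M (if u then i.rev else i) (if v then j.rev else j)

theorem reflect_reflect (u v : Bool) (M : Mat m n) : reflect u v (reflect u v M) = M := by
  funext i j
  cases u <;> cases v <;> simp [reflect]

/-- An order embedding between finite ordinals, conjugated by the order reversals if `u`. -/
def reflectEmb (u : Bool) (f : Fin k ↪o Fin m) : Fin k ↪o Fin m :=
  OrderEmbedding.ofStrictMono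
    (fun i => if u then (f (if u then i.rev else i)).rev else f (if u then i.rev else i)) (by
      intro i j h
      cases u <;> simpa)

theorem Contains.reflect {M : Mat m n} {P : Mat k l} (u v : Bool) (h : Contains M P) :
    Contains (reflect u v M) (reflect u v P) := by
  obtain ⟨f, g, hfg⟩ := h
  refine ⟨reflectEmb u f, reflectEmb v g, fun i j hij => ?_⟩
  have := hfg _ _ hij
  cases u <;> cases v <;> simpa [ZeroOneMatrix.reflect, reflectEmb] using this

theorem contains_reflect_comm {M : Mat m n} {P : Mat k l} (u v : Bool) :
    Contains (reflect u v M) P ↔ Contains M (reflect u v P) := by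
  refine ⟨fun h => ?_, fun h => ?_⟩ <;> simpa only [reflect_reflect] using h.reflect u v

theorem numOnes_reflect (u v : Bool) (M : Mat m n) : numOnes (reflect u v M) = numOnes M := by
  have hle : ∀ M : Mat m n, numOnes (reflect u v M) ≤ numOnes M := by
    intro M
    refine Finset.card_le_card_of_injOn
      (fun p => (if u then p.1.rev else p.1, if v then p.2.rev else p.2)) ?_ ?_
    · intro p hp
      simp only [Finset.coe_filter, Set.mem_ofPred_eq] at hp ⊢
      exact ⟨Finset.mem_univ _, hp.2⟩
    · intro p _ q _ h
      cases u <;> cases v <;> simpa [Prod.ext_iff] using h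
  refine (hle M).antisymm ?_
  simpa only [reflect_reflect] using hle (reflect u v M)

theorem ex_reflect (u v : Bool) (P : Mat k l) : ex n (reflect u v P) = ex n P := by
  have hle : ∀ P : Mat k l, ex n (reflect u v P) ≤ ex n P := by
    intro P
    refine ex_le fun M hM => ?_
    rw [← numOnes_reflect u v]
    exact numOnes_le_ex fun h => hM ((contains_reflect_comm u v).1 h)
  refine (hle P).antisymm ?_
  simpa only [reflect_reflect] using hle (reflect u v P)

theorem isLinear_reflect (u v : Bool) (P : Mat k l) : IsLinear (reflect u v P) ↔ IsLinear P := by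
  simp only [IsLinear, ex_reflect]

theorem Same.reflect {k' l' : ℕ} {P : Mat k l} {P' : Mat k' l'} (u v : Bool) (h : Same P P') :
    Same (reflect u v P) (reflect u v P') := by
  obtain ⟨rfl, rfl, h⟩ := h
  exact ⟨rfl, rfl, fun i j => h _ _⟩

theorem MinimallyNonlinear.reflect {P : Mat k l} (u v : Bool) (h : MinimallyNonlinear P) :
    MinimallyNonlinear (reflect u v P) := by
  refine ⟨?_, fun k' l' P' hP' hne => ?_⟩
  · simpa only [IsSuperlinear, ex_reflect] using h.1
  · refine (isLinear_reflect u v P').1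
      (h.2 k' l' _ ((contains_reflect_comm u v).1 hP') fun hs => ?_)
    exact hne (by simpa only [reflect_reflect] using hs.reflect u v)

end Reflection

/-! ### Removing ones that no other row separates -/

theorem MinimallyNonlinear.not_isLinear {k l : ℕ} {P : Mat k l} (h : MinimallyNonlinear P) :
    ¬ IsLinear P := by
  intro hl
  have := h.1.trans_isBigO hl
  obtain ⟨n, hn, hn'⟩ :=
    ((this.bound (c := 1 / 2) (by norm_num)).and (eventually_gt_atTop 0)).exists
  rw [Real.norm_natCast] at hn
  have : (0 : ℝ) < n := by exact_mod_cast hn'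
  linarith

theorem numOnes_le_mul_ex {k l n : ℕ} {P P' : Mat k l} {r : Fin k} {a b : Fin l} (hab : a < b)
    (ha : P' r a = true) (hb : P' r b = true)
    (hP : ∀ i j, P i j = true → P' i j = true ∧ (j ≤ a ∨ b ≤ j) ∨ i = r ∧ a < j ∧ j < b)
    {A : Mat n n} (hA : Avoids A P) : numOnes A ≤ l * ex n P' := by
  classical
  let S : Fin n → Finset (Fin n) := fun i => Finset.univ.filter fun j => A i j = true
  let e : ∀ i, Fin (S i).card ↪o Fin n := fun i => (S i).orderEmbOfFin rfl
  -- The ones of each row are split by their rank in the row modulo `l`.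
  let B : ℕ → Mat n n := fun t i j => decide (∃ u, e i u = j ∧ u.1 % l = t)
  have hl : 0 < l := a.pos
  have hB : ∀ t, Avoids (B t) P' := by
    rintro t ⟨f, g, hfg⟩
    have h1 := hfg r a ha
    have h2 := hfg r b hb
    simp only [B, decide_eq_true_eq] at h1 h2
    obtain ⟨u, hu, hut⟩ := h1
    obtain ⟨v, hv, hvt⟩ := h2
    have huv : u < v := by rwa [← (e (f r)).lt_iff_lt, hu, hv, g.lt_iff_lt]
    -- Distinct ones of one class have ranks at least `l` apart, which leaves enough ones of `A`
    -- between them for all columns between `a` and `b`.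
    have huv' : u.1 + l ≤ v.1 := by
      have := (Nat.modEq_iff_dvd' (Fin.lt_def.1 huv).le).1 (hut.trans hvt.symm : u.1 ≡ v.1 [MOD l])
      have := Nat.le_of_dvd (Nat.sub_pos_of_lt huv) this
      lia
    have hlt : ∀ j : Fin l, u.1 + (j.1 - a.1) < (S (f r)).card := fun j => by
      have := v.2
      have := j.2
      lia
    -- Only the columns between `a` and `b` are moved, onto consecutive ones of row `f r`; there `P`
    -- has no ones outside row `r`.
    let g' : Fin l → Fin n := fun j =>
      if a < j ∧ j < b then e (f r) ⟨u.1 + (j.1 - a.1), hlt j⟩ else g j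
    have hmem : ∀ j, a < j → j < b → g a < g' j ∧ g' j < g b := by
      intro j h1 h2
      rw [← hu, ← hv, show g' j = _ from if_pos ⟨h1, h2⟩, OrderEmbedding.lt_iff_lt,
        OrderEmbedding.lt_iff_lt, Fin.lt_def, Fin.lt_def]
      simp only
      rw [Fin.lt_def] at h1
      have := j.2
      lia
    have hg' : StrictMono g' := by
      intro i j hij
      by_cases hi : a < i ∧ i < b <;> by_cases hj : a < j ∧ j < b
      · rw [show g' i = _ from if_pos hi, show g' j = _ from if_pos hj,
          OrderEmbedding.lt_iff_lt, Fin.lt_def]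
        simp only
        have := Fin.lt_def.1 hi.1
        have := Fin.lt_def.1 hij
        lia
      · have hbj : b ≤ j := not_lt.1 fun h => hj ⟨hi.1.trans hij, h⟩
        simpa only [g', if_neg hj] using (hmem i hi.1 hi.2).2.trans_le (g.le_iff_le.2 hbj)
      · have hia : i ≤ a := not_lt.1 fun h => hi ⟨h, hij.trans hj.2⟩
        simpa only [g', if_neg hi] using (g.le_iff_le.2 hia).trans_lt (hmem j hj.1 hj.2).1
      · simpa only [g', if_neg hi, if_neg hj, OrderEmbedding.lt_iff_lt]
    have hS : ∀ i w, A i (e i w) = true := fun i w =>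
      (Finset.mem_filter.1 ((S i).orderEmbOfFin_mem rfl w)).2
    refine hA ⟨f, OrderEmbedding.ofStrictMono g' hg', fun i j hij => ?_⟩
    change A (f i) (g' j) = true
    obtain ⟨h, h'⟩ | ⟨rfl, h⟩ := hP i j hij
    · have hj : ¬ (a < j ∧ j < b) := fun hj => h'.elim hj.1.not_ge hj.2.not_ge
      have := hfg i j h
      simp only [B, decide_eq_true_eq] at this
      obtain ⟨w, hw, -⟩ := this
      simp only [g', if_neg hj, ← hw, hS]
    · simp only [g', if_pos h, hS]
  have hsub : (Finset.univ.filter fun p : Fin n × Fin n => A p.1 p.2 = true) ⊆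
      (Finset.range l).biUnion fun t =>
        Finset.univ.filter fun p : Fin n × Fin n => B t p.1 p.2 = true := by
    intro p hp
    have hp' : p.2 ∈ Set.range (e p.1) := by
      rw [Finset.range_orderEmbOfFin]
      simpa [S] using hp
    obtain ⟨u, hu⟩ := hp'
    simp only [Finset.mem_biUnion, Finset.mem_range, Finset.mem_filter, Finset.mem_univ, true_and,
      B, decide_eq_true_eq]
    exact ⟨u.1 % l, Nat.mod_lt _ hl, u, hu, rfl⟩
  calc numOnes A ≤ _ := Finset.card_le_card hsub
    _ ≤ (Finset.range l).card * ex n P' :=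
      Finset.card_biUnion_le_card_mul _ _ _ fun t _ => numOnes_le_ex (hB t)
    _ = l * ex n P' := by rw [Finset.card_range]

theorem IsLinear.of_between {k l : ℕ} {P P' : Mat k l} {r : Fin k} {a b : Fin l} (hab : a < b)
    (ha : P' r a = true) (hb : P' r b = true)
    (hP : ∀ i j, P i j = true → P' i j = true ∧ (j ≤ a ∨ b ≤ j) ∨ i = r ∧ a < j ∧ j < b)
    (h : IsLinear P') : IsLinear P := by
  refine IsBigO.trans (IsBigO.of_bound l (Eventually.of_forall fun n => ?_)) h
  rw [Real.norm_natCast, Real.norm_natCast]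
  exact_mod_cast ex_le fun A => numOnes_le_mul_ex hab ha hb hP

/-- Between two ones of a row which are not consecutive there is a one in another row. -/
theorem MinimallyNonlinear.exists_between {k l : ℕ} {P : Mat k l} (h : MinimallyNonlinear P)
    {r : Fin k} {a b c : Fin l} (hab : a < b) (hbc : b < c) (ha : P r a = true) (hb : P r b = true)
    (hc : P r c = true) : ∃ i j, i ≠ r ∧ a < j ∧ j < c ∧ P i j = true := by
  by_contra! hno
  -- Erasing the middle one gives a proper submatrix pattern, linear by minimality; the ones at `a`
  -- and `c` let it be restored.
  let P' : Mat k l := fun i j => P i j && !decide (i = r ∧ j = b)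
  have hsub : Contains P P' := ⟨RelEmbedding.refl _, RelEmbedding.refl _, fun i j hij =>
    (Bool.and_eq_true_iff.1 hij).1⟩
  have hne : ¬ Same P P' := by
    rintro ⟨_, _, hs⟩
    have := hs r b
    simp [P', hb] at this
  refine h.not_isLinear (IsLinear.of_between (hab.trans hbc) (r := r) (P' := P') ?_ ?_ ?_
    (h.2 _ _ _ hsub hne))
  · simp [P', ha, hab.ne]
  · simp [P', hc, hbc.ne']
  · intro i j hij
    by_cases hj : a < j ∧ j < c
    · exact Or.inr ⟨by_contra fun hi => hno i j hi hj.1 hj.2 hij, hj⟩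
    · have hj' : j ≤ a ∨ c ≤ j := by
        by_contra! hj'
        exact hj hj'
      refine Or.inl ⟨?_, hj'⟩
      have : j ≠ b := fun h => hj (h ▸ ⟨hab, hbc⟩)
      simp [P', hij, this]

/-! ### Five ones in the top row -/

theorem strictMono_vec4 {n : ℕ} {p q r s : Fin n} (hpq : p < q) (hqr : q < r) (hrs : r < s) :
    StrictMono ![p, q, r, s] := by
  refine Fin.strictMono_iff_lt_succ.2 fun i => ?_
  fin_cases i <;> assumption

/-- The four ones alone form a non-linear matrix with four columns contained in `P`; if `P` were
wider, this would contradict minimality. -/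
theorem MinimallyNonlinear.width_le_four {k l : ℕ} {P : Mat k l} (h : MinimallyNonlinear P)
    {x y z : Fin k} {p q r s : Fin l} (hpq : p < q) (hqr : q < r) (hrs : r < s) (hxy : x < y)
    (hyz : y ≤ z) (hp : P x p = true) (hq : P y q = true) (hr : P x r = true)
    (hs : P z s = true) : l ≤ 4 := by
  by_contra hl
  obtain rfl | hyz := hyz.eq_or_lt
  · let S : Mat 2 4 := !![true, false, true, false; false, true, false, true]
    have hc : Contains P S := by
      refine ⟨OrderEmbedding.ofStrictMono ![x, y] ?_,
        OrderEmbedding.ofStrictMono _ (strictMono_vec4 hpq hqr hrs), fun i j => ?_⟩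
      · refine Fin.strictMono_iff_lt_succ.2 fun i => ?_
        fin_cases i
        exact hxy
      · fin_cases i <;> fin_cases j <;> simp [S, hp, hq, hr, hs]
    exact ZeroOneMatrix.not_isLinear 0 1 1 0 1 2 3 (by decide) (by decide) (by decide) (by decide)
      le_rfl rfl rfl rfl rfl (h.2 _ _ S hc fun ⟨_, h4, _⟩ => hl h4.le)
  · let S : Mat 3 4 := !![true, false, true, false; false, true, false, false;
      false, false, false, true]
    have hc : Contains P S := by
      refine ⟨OrderEmbedding.ofStrictMono ![x, y, z] ?_,
        OrderEmbedding.ofStrictMono _ (strictMono_vec4 hpq hqr hrs), fun i j => ?_⟩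
      · refine Fin.strictMono_iff_lt_succ.2 fun i => ?_
        fin_cases i <;> assumption
      · fin_cases i <;> fin_cases j <;> simp [S, hp, hq, hr, hs]
    exact ZeroOneMatrix.not_isLinear 0 1 2 0 1 2 3 (by decide) (by decide) (by decide) (by decide)
      (by decide) rfl rfl rfl rfl (h.2 _ _ S hc fun ⟨_, h4, _⟩ => hl h4.le)

theorem MinimallyNonlinear.rowOnes_zero_le_four {h w : ℕ} {M : Mat (h + 1) w}
    (hM : MinimallyNonlinear M) : rowOnes M 0 ≤ 4 := by
  by_contra! hlt
  let e := (Finset.univ.filter fun c : Fin w => M 0 c = true).orderEmbOfFin rfl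
  have he : ∀ i, M 0 (e i) = true := fun i =>
    (Finset.mem_filter.1 (Finset.orderEmbOfFin_mem _ rfl i)).2
  let c : Fin 5 ↪o Fin w := (Fin.castLEOrderEmb hlt).trans e
  have hc : ∀ i, M 0 (c i) = true := fun i => he _
  have hlt' : ∀ i j : Fin 5, i < j → c i < c j := fun i j => c.lt_iff_lt.2
  have hw : 5 ≤ w := by simpa using Fintype.card_le_of_embedding c.toEmbedding
  obtain ⟨y, q, hy, h0q, hq2, hq⟩ := hM.exists_between (hlt' 0 1 (by decide)) (hlt' 1 2 (by decide))
    (hc 0) (hc 1) (hc 2)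
  obtain ⟨z, s, hz, h2s, hs4, hs⟩ := hM.exists_between (hlt' 2 3 (by decide)) (hlt' 3 4 (by decide))
    (hc 2) (hc 3) (hc 4)
  obtain hyz | hzy := le_total y z
  · exact Nat.not_le_of_gt hw (hM.width_le_four h0q hq2 h2s (Fin.pos_of_ne_zero hy) hyz (hc 0) hq
      (hc 2) hs)
  -- Read from right to left, the ones in columns `c 4`, `s`, `c 2`, `q` form the same pattern, with
  -- `z` now the row that must not lie below the other.
  · refine Nat.not_le_of_gt hw ((hM.reflect false true).width_le_four (x := 0) (y := z) (z := y)
      (p := (c 4).rev) (q := s.rev) (r := (c 2).rev) (s := q.rev) (Fin.rev_lt_rev.2 hs4)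
      (Fin.rev_lt_rev.2 h2s) (Fin.rev_lt_rev.2 hq2) (Fin.pos_of_ne_zero hz) hzy ?_ ?_ ?_ ?_) <;>
    simpa [ZeroOneMatrix.reflect] using by first | exact hc _ | assumption

end ZeroOneMatrix

theorem mainTheorem5 (h w : ℕ) (M : ZeroOneMatrix.Mat (h + 1) w)
    (hM : ZeroOneMatrix.MinimallyNonlinear M) :
    ZeroOneMatrix.rowOnes M 0 ≤ 4 ∧ ZeroOneMatrix.rowOnes M (Fin.last h) ≤ 4 := by
  refine ⟨hM.rowOnes_zero_le_four, ?_⟩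
  have := (hM.reflect true false).rowOnes_zero_le_four
  simpa [ZeroOneMatrix.rowOnes, ZeroOneMatrix.reflect] using this
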